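/- **Proposition 3.3.** Let $X$ be a compact (connected) Riemann surface, $n\ge 0$, and let $C=(L_0,\dots,L_n;\phi_1,\dots,\phi_n)$ be a holomorphic chain on $X$ of type $\boldsymbol t=(1,\dots,1;d_0,\dots,d_n)$: the $L_i$ are holomorphic line bundles of degree $d_i$ and $\phi_i:L_i\to L_{i-1}$ are homomorphisms ($1\le i\le n$). For $\boldsymbol\alpha=(\alpha_1,\dots,\alpha_n)\in\mathbb R^n$, the $\boldsymbol\alpha$-slope of a nonzero chain of type $(r_0,\dots,r_n;e_0,\dots,e_n)$ (ranks and degrees) is $$\mu_{\boldsymbol\alpha}=\frac{\sum_{i=0}^n e_i+\sum_{i=1}^n\alpha_i r_i}{\sum_{i=0}^n r_i}.$$ A subchain of $C$ is a tuple of coherent subsheaves $F_i\subseteq L_i$ with $\phi_i(F_i)\subseteq F_{i-1}$, together with the restrictions of the $\phi_i$; it is proper if it is neither $0$ nor $C$. The chain $C$ is $\boldsymbol\alpha$-stable (respectively $\boldsymbol\alpha$-semistable) if $\mu_{\boldsymbol\alpha}(C')<\mu_{\boldsymbol\alpha}(C)$ (respectively $\mu_{\boldsymbol\alpha}(C')\le\mu_{\boldsymbol\alpha}(C)$)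 for all proper subchains $C'$ of $C$. Let $H\subseteq\mathbb R^n$ be the set of all $\boldsymbol\alpha$ such that, for $i=0,\dots,n-1$, the $\boldsymbol\alpha$-slope of the type $(1,\dots,1,0,\dots,0;d_0,\dots,d_i,0,\dots,0)$ (with $i+1$ ones) of the standard subchain $(L_0,\dots,L_i,0,\dots,0)$ is strictly less than $\mu_{\boldsymbol\alpha}(C)$. Then, for every $\boldsymbol\alpha\in H$, the chain $C$ is $\boldsymbol\alpha$-semistable if and only if it is $\boldsymbol\alpha$-stable. -/

import Mathlib

open scoped Manifold ContDiff Bundle Topology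

/-- A holomorphic vector bundle of (constant) rank `rank` on `X`: a Mathlib vector bundle with model
fibre `ℂ ^ rank` whose transition functions are complex analytic. -/
structure HolBundle (X : Type*) [TopologicalSpace X] [ChartedSpace ℂ X] where
  rank : ℕ
  Fiber : X → Type
  [addCommGroup : ∀ x, AddCommGroup (Fiber x)]
  [module : ∀ x, Module ℂ (Fiber x)]
  [topFiber : ∀ x, TopologicalSpace (Fiber x)]
  [topTotal : TopologicalSpace (Bundle.TotalSpace (Fin rank → ℂ) Fiber)]
  [fiberBundle : FiberBundle (Fin rank → ℂ) Fiber]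
  [vectorBundle : VectorBundle ℂ (Fin rank → ℂ) Fiber]
  [holomorphic : ContMDiffVectorBundle ω (Fin rank → ℂ) Fiber 𝓘(ℂ)]

attribute [instance] HolBundle.addCommGroup HolBundle.module HolBundle.topFiber
  HolBundle.topTotal HolBundle.fiberBundle HolBundle.vectorBundle HolBundle.holomorphic

namespace HolBundle

variable {X : Type*} [TopologicalSpace X] [ChartedSpace ℂ X]

/-- The total space of a holomorphic vector bundle. -/
abbrev Total (E : HolBundle X) : Type _ := Bundle.TotalSpace (Fin E.rank → ℂ) E.Fiber

/-- The set-theoretic section `s` is a holomorphic section of `E` over the set `U`. -/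
def IsHolSection (E : HolBundle X) (U : Set X) (s : ∀ x, E.Fiber x) : Prop :=
  ContMDiffOn 𝓘(ℂ) (𝓘(ℂ).prod 𝓘(ℂ, Fin E.rank → ℂ)) ω (fun x => (⟨x, s x⟩ : E.Total)) U

/-- A homomorphism of holomorphic vector bundles over `X`: a family of linear maps of the fibres
which is holomorphic as a map of total spaces. -/
structure Hom (E F : HolBundle X) where
  app : ∀ x, E.Fiber x →ₗ[ℂ] F.Fiber x
  holomorphic : ContMDiff (𝓘(ℂ).prod 𝓘(ℂ, Fin E.rank → ℂ)) (𝓘(ℂ).prod 𝓘(ℂ, Fin F.rank → ℂ)) ω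
    (fun v : E.Total => (⟨v.proj, app v.proj v.2⟩ : F.Total))

/-- `f` is injective as a homomorphism of sheaves of holomorphic sections (it may fail to be
injective on some fibres). -/
def Hom.SheafInjective {E F : HolBundle X} (f : E.Hom F) : Prop :=
  ∀ U : Set X, IsOpen U → ∀ s : ∀ x, E.Fiber x, E.IsHolSection U s →
    (∀ x ∈ U, f.app x (s x) = 0) → ∀ x ∈ U, s x = 0

/-- `f` is an isomorphism of holomorphic vector bundles. -/
def Hom.IsIso {E F : HolBundle X} (f : E.Hom F) : Prop :=
  ∃ g : F.Hom E, (∀ x v, g.app x (f.app x v) = v) ∧ (∀ x w, f.app x (g.app x w) = w)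

/-- The set-theoretic section `s`, written near the point `p` in the preferred chart of `X` and the
preferred trivialization of `E` at `p`. -/
noncomputable def localRep (E : HolBundle X) (p : X) (s : ∀ x, E.Fiber x) : ℂ → Fin E.rank → ℂ :=
  fun z => (trivializationAt (Fin E.rank → ℂ) E.Fiber p
    (⟨(chartAt ℂ p).symm z, s ((chartAt ℂ p).symm z)⟩ : E.Total)).2

/-- `s` is a (global) meromorphic section of `E`; its values at the poles are irrelevant. -/
def IsMeromorphicSection (E : HolBundle X) (s : ∀ x, E.Fiber x) : Prop :=
  ∀ p : X, MeromorphicAt (E.localRep p s) (chartAt ℂ p p)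

/-- The order at `p` of `s₁ ∧ ⋯ ∧ sᵣ`, as a meromorphic section of the determinant line bundle of
`E`; it is `⊤` if `s₁ ∧ ⋯ ∧ sᵣ` vanishes identically near `p`. For a line bundle this is the order
of the section `s₁` at `p`. -/
noncomputable def detOrder (E : HolBundle X) (s : Fin E.rank → ∀ x, E.Fiber x) (p : X) :
    WithTop ℤ :=
  meromorphicOrderAt (fun z => (Matrix.of fun i j => E.localRep p (s i) z j).det) (chartAt ℂ p p)

/-- `s₁, …, sᵣ` is a meromorphic frame of `E`: meromorphic sections such that `s₁ ∧ ⋯ ∧ sᵣ` is a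
nonzero meromorphic section of `det E`. For a line bundle: a nonzero meromorphic section. -/
def IsMeromorphicFrame (E : HolBundle X) (s : Fin E.rank → ∀ x, E.Fiber x) : Prop :=
  (∀ i, E.IsMeromorphicSection (s i)) ∧ ∀ p, E.detOrder s p ≠ ⊤

/-- `deg E = d`: the number of zeros minus the number of poles of `s₁ ∧ ⋯ ∧ sᵣ` is `d`, where
`s₁, …, sᵣ` is a meromorphic frame of `E`. (On a compact Riemann surface the sum is finite, and it
does not depend on the frame.) -/
def HasDegree (E : HolBundle X) (d : ℤ) : Prop :=
  ∃ s : Fin E.rank → ∀ x, E.Fiber x, E.IsMeromorphicFrame s ∧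
    ∑ᶠ p : X, (E.detOrder s p).untop₀ = d

end HolBundle

/-- A type `(r₀, …, rₙ; d₀, …, dₙ)` of chains. -/
structure ChainType (n : ℕ) where
  rank : Fin (n + 1) → ℕ
  deg : Fin (n + 1) → ℤ

namespace ChainType

variable {n : ℕ}

/-- The `α`-slope `(∑_{i=0}^n dᵢ + ∑_{i=1}^n αᵢ rᵢ) / ∑_{i=0}^n rᵢ` of chains of type `t`, where
`α = (α₁, …, αₙ)`: the entry `α k` for `k : Fin n` stands for `α_{k+1}`. -/
noncomputable def slope (α : Fin n → ℝ) (t : ChainType n) : ℝ :=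
  ((∑ i, (t.deg i : ℝ)) + ∑ k : Fin n, α k * (t.rank k.succ : ℝ)) / ∑ i, (t.rank i : ℝ)

/-- The type `(r₀, …, rᵢ, 0, …, 0; d₀, …, dᵢ, 0, …, 0)` of the `i`-th standard subchain
`(E₀, …, Eᵢ, 0, …, 0)` of a chain of type `t`. -/
def standard (t : ChainType n) (i : Fin (n + 1)) : ChainType n where
  rank j := if j ≤ i then t.rank j else 0
  deg j := if j ≤ i then t.deg j else 0

/-- The region `H` of the parameter space: the slope of the `i`-th standard subchain is smaller than
the slope of the whole chain, for `i = 0, …, n - 1`. -/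
def H (t : ChainType n) : Set (Fin n → ℝ) :=
  {α | ∀ i : Fin n, slope α (t.standard i.castSucc) < slope α t}

end ChainType

/-- A holomorphic chain `(E₀, …, Eₙ; φ₁, …, φₙ)` on `X`, with `φᵢ : Eᵢ → Eᵢ₋₁`; `map k` for
`k : Fin n` is `φ_{k+1}`. -/
structure HolChain (X : Type*) [TopologicalSpace X] [ChartedSpace ℂ X] (n : ℕ) where
  bundle : Fin (n + 1) → HolBundle X
  map : ∀ k : Fin n, (bundle k.succ).Hom (bundle k.castSucc)

namespace HolChain

variable {X : Type*} [TopologicalSpace X] [ChartedSpace ℂ X] {n : ℕ}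

/-- The chain `C` is of type `t`. -/
def HasType (C : HolChain X n) (t : ChainType n) : Prop :=
  ∀ i, (C.bundle i).rank = t.rank i ∧ (C.bundle i).HasDegree (t.deg i)

/-- A subchain of `C`. Coherent subsheaves `Fᵢ` of `Eᵢ` are vector bundles, so a subsheaf is given
by a holomorphic vector bundle and a homomorphism to `Eᵢ` that is injective on sheaves; that `φᵢ`
maps `Fᵢ` to `Fᵢ₋₁` means that it restricts to the map of the chain `F`. -/
structure Subchain (C : HolChain X n) where
  chain : HolChain X n
  incl : ∀ i, (chain.bundle i).Hom (C.bundle i)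
  incl_injective : ∀ i, (incl i).SheafInjective
  comm : ∀ (k : Fin n) (x : X) (v : (chain.bundle k.succ).Fiber x),
    (incl k.castSucc).app x ((chain.map k).app x v) = (C.map k).app x ((incl k.succ).app x v)

/-- A proper subchain: one that is neither zero nor all of `C`. -/
def Subchain.IsProper {C : HolChain X n} (S : C.Subchain) : Prop :=
  (∃ i, (S.chain.bundle i).rank ≠ 0) ∧ ¬ ∀ i, (S.incl i).IsIso

/-- `C` is `α`-stable: every proper subchain has smaller `α`-slope. -/
def IsStable (C : HolChain X n) (α : Fin n → ℝ) : Prop :=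
  ∀ t, C.HasType t → ∀ S : C.Subchain, S.IsProper →
    ∀ t', S.chain.HasType t' → t'.slope α < t.slope α

/-- `C` is `α`-semistable: no proper subchain has larger `α`-slope. -/
def IsSemistable (C : HolChain X n) (α : Fin n → ℝ) : Prop :=
  ∀ t, C.HasType t → ∀ S : C.Subchain, S.IsProper →
    ∀ t', S.chain.HasType t' → t'.slope α ≤ t.slope α

end HolChain

/-!
Only the passage from semistability to stability needs an argument. Let `F` be a proper subchain of
a semistable chain `C` of line bundles `Lᵢ`. Each `Fᵢ` has rank at most one
(`HolBundle.Hom.SheafInjective.rank_le_one`).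

* If some `F_{k+1}` is nonzero while `F_k` is zero, then `φ_{k+1}` vanishes on a nonzero subsheaf,
  so it is zero (`HolBundle.Hom.app_eq_zero_of_comp_eq_zero`), and `(0, …, 0, L_{k+1}, …, Lₙ)` is a
  subchain. The slope of `C` is a weighted mean of its slope and that of the standard subchain
  `(L₀, …, L_k, 0, …, 0)`; as the latter is too small for `α` in `H`, the former is too large,
  which contradicts semistability (`ChainType.slope_lt_slope_tail`).
* Otherwise the nonzero `Fᵢ` are `F₀, …, F_k`. Their degrees are at most those of `L₀, …, L_k`, with
  equality only if `Fᵢ = Lᵢ` (`HolBundle.HasDegree.exists_ge_of_sheafInjective`). So the slope of `F`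
  is at most that of a standard subchain if `k < n`, and if `k = n` it is smaller than that of `C`
  because some `Fᵢ` is not `Lᵢ`.

The comparison of degrees uses that the degree of a line bundle does not depend on the section that
computes it. The residue theorem is not needed for this: if sections `s` and `t` of `Lᵢ` had
different degrees, then the sections `(s / t)ᵏ s` would give `Lᵢ` arbitrarily small degrees
(`HolBundle.HasDegree.exists_le_of_ne`), hence `C` arbitrarily small slopes, and the subchain `F`
would violate semistability (`HolChain.IsSemistable.deg_unique`).
-/

/-! ### Orders of functions on a Riemann surface -/

section OrderAtPoint

open Filter

variable {X : Type*} [TopologicalSpace X] [ChartedSpace ℂ X]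

/-- The function `h` on `X` is meromorphic at `p`, read in the preferred chart at `p`. -/
def MeroAt (h : X → ℂ) (p : X) : Prop :=
  MeromorphicAt (h ∘ (chartAt ℂ p).symm) (chartAt ℂ p p)

/-- The order at `p` of the function `h` on `X`, read in the preferred chart at `p`. -/
noncomputable def ordAt (h : X → ℂ) (p : X) : WithTop ℤ :=
  meromorphicOrderAt (h ∘ (chartAt ℂ p).symm) (chartAt ℂ p p)

lemma tendsto_chartAt_symm (p : X) :
    Tendsto (chartAt ℂ p).symm (𝓝 (chartAt ℂ p p)) (𝓝 p) :=
  (chartAt ℂ p).tendsto_symm (mem_chart_source ℂ p)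

lemma eventuallyEq_comp_chartAt_symm {h k : X → ℂ} {p : X} (e : h =ᶠ[𝓝 p] k) :
    h ∘ (chartAt ℂ p).symm =ᶠ[𝓝 (chartAt ℂ p p)] k ∘ (chartAt ℂ p).symm :=
  e.comp_tendsto (tendsto_chartAt_symm p)

lemma ordAt_congr {h k : X → ℂ} {p : X} (e : h =ᶠ[𝓝 p] k) : ordAt h p = ordAt k p :=
  meromorphicOrderAt_congr ((eventuallyEq_comp_chartAt_symm e).filter_mono nhdsWithin_le_nhds)

lemma MeroAt.congr {h k : X → ℂ} {p : X} (hh : MeroAt h p) (e : h =ᶠ[𝓝 p] k) : MeroAt k p :=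
  MeromorphicAt.congr hh
    ((eventuallyEq_comp_chartAt_symm e).filter_mono nhdsWithin_le_nhds)

lemma MeroAt.mul {h k : X → ℂ} {p : X} (hh : MeroAt h p) (hk : MeroAt k p) :
    MeroAt (h * k) p :=
  MeromorphicAt.mul hh hk

lemma MeroAt.div {h k : X → ℂ} {p : X} (hh : MeroAt h p) (hk : MeroAt k p) :
    MeroAt (h / k) p :=
  MeromorphicAt.div hh hk

lemma ordAt_mul {h k : X → ℂ} {p : X} (hh : MeroAt h p) (hk : MeroAt k p) :
    ordAt (h * k) p = ordAt h p + ordAt k p :=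
  meromorphicOrderAt_mul hh hk

lemma ordAt_div {h k : X → ℂ} {p : X} (hh : MeroAt h p) (hk : MeroAt k p) :
    ordAt (h / k) p = ordAt h p - ordAt k p :=
  meromorphicOrderAt_div hh hk

variable [IsManifold 𝓘(ℂ) ω X]

lemma contMDiffAt_iff_analyticAt {h : X → ℂ} {p q : X} (hq : q ∈ (chartAt ℂ p).source) :
    ContMDiffAt 𝓘(ℂ) 𝓘(ℂ) ω h q ↔
      AnalyticAt ℂ (h ∘ (chartAt ℂ p).symm) (chartAt ℂ p q) := by
  rw [contMDiffAt_iff_source_of_mem_source hq, contMDiffWithinAt_iff_contDiffWithinAt]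
  simp only [extChartAt, OpenPartialHomeomorph.extend, modelWithCornersSelf_partialEquiv,
    PartialEquiv.trans_refl, modelWithCornersSelf_coe, Set.range_id,
    contDiffWithinAt_omega_iff_analyticWithinAt, analyticWithinAt_univ,
    OpenPartialHomeomorph.toFun_eq_coe, OpenPartialHomeomorph.coe_toPartialEquiv_symm]

lemma ContMDiffAt.analyticAt_chart {h : X → ℂ} {p : X} (hh : ContMDiffAt 𝓘(ℂ) 𝓘(ℂ) ω h p) :
    AnalyticAt ℂ (h ∘ (chartAt ℂ p).symm) (chartAt ℂ p p) :=
  (contMDiffAt_iff_analyticAt (mem_chart_source ℂ p)).1 hh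

lemma ContMDiffAt.meroAt {h : X → ℂ} {p : X} (hh : ContMDiffAt 𝓘(ℂ) 𝓘(ℂ) ω h p) :
    MeroAt h p :=
  hh.analyticAt_chart.meromorphicAt

lemma ContMDiffAt.ordAt_nonneg {h : X → ℂ} {p : X} (hh : ContMDiffAt 𝓘(ℂ) 𝓘(ℂ) ω h p) :
    0 ≤ ordAt h p :=
  hh.analyticAt_chart.meromorphicOrderAt_nonneg

lemma ContMDiffAt.ordAt_eq_zero_iff {h : X → ℂ} {p : X}
    (hh : ContMDiffAt 𝓘(ℂ) 𝓘(ℂ) ω h p) : ordAt h p = 0 ↔ h p ≠ 0 := by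
  have ha := hh.analyticAt_chart
  have : (h ∘ (chartAt ℂ p).symm) (chartAt ℂ p p) = h p := by simp
  rw [← this, ← ha.analyticOrderAt_eq_zero, ordAt, ha.meromorphicOrderAt_eq]
  cases hn : analyticOrderAt (h ∘ (chartAt ℂ p).symm) (chartAt ℂ p p) with
  | top => simp
  | coe n => simp

lemma ContMDiffAt.eventually_eq_zero_of_ordAt_eq_top {h : X → ℂ} {p : X}
    (hh : ContMDiffAt 𝓘(ℂ) 𝓘(ℂ) ω h p) (htop : ordAt h p = ⊤) : ∀ᶠ x in 𝓝 p, h x = 0 := by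
  have ha := hh.analyticAt_chart
  have h0 : analyticOrderAt (h ∘ (chartAt ℂ p).symm) (chartAt ℂ p p) = ⊤ := by
    rw [ordAt, ha.meromorphicOrderAt_eq] at htop
    simpa using htop
  have h1 := ((chartAt ℂ p).continuousAt (mem_chart_source ℂ p)).eventually
    (analyticOrderAt_eq_top.1 h0)
  filter_upwards [h1, (chartAt ℂ p).open_source.mem_nhds (mem_chart_source ℂ p)] with x hx hxs
  simpa [hxs] using hx

/-- A meromorphic function of finite order at `p` is holomorphic and nonvanishing at all points
near `p` other than `p`. -/
lemma MeroAt.eventually_contMDiffAt_ne_zero {h : X → ℂ} {p : X} (hh : MeroAt h p)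
    (hne : ordAt h p ≠ ⊤) : ∀ᶠ q in 𝓝[≠] p, ContMDiffAt 𝓘(ℂ) 𝓘(ℂ) ω h q ∧ h q ≠ 0 := by
  have h1 := MeromorphicAt.eventually_analyticAt hh
  have h2 := (meromorphicOrderAt_ne_top_iff_eventually_ne_zero hh).1 hne
  have hs : ∀ᶠ q in 𝓝[≠] p, q ∈ (chartAt ℂ p).source :=
    nhdsWithin_le_nhds ((chartAt ℂ p).open_source.mem_nhds (mem_chart_source ℂ p))
  have ht : Tendsto (chartAt ℂ p) (𝓝[≠] p) (𝓝[≠] (chartAt ℂ p p)) := by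
    refine tendsto_nhdsWithin_iff.2 ⟨((chartAt ℂ p).continuousAt
      (mem_chart_source ℂ p)).tendsto.mono_left nhdsWithin_le_nhds, ?_⟩
    filter_upwards [hs, self_mem_nhdsWithin] with q hq hqp heq
    exact hqp ((chartAt ℂ p).injOn hq (mem_chart_source ℂ p) heq)
  filter_upwards [ht.eventually h1, ht.eventually h2, hs] with q ha h0 hq
  exact ⟨(contMDiffAt_iff_analyticAt hq).2 ha, by simpa [hq] using h0⟩

end OrderAtPoint

/-! ### Coordinates and local sections of a vector bundle -/

namespace HolBundle

open Filter

variable {X : Type*} [TopologicalSpace X] [ChartedSpace ℂ X]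

section Coordinates

variable (E : HolBundle X)

/-- The open set over which the preferred trivialization of `E` at `p` is defined. -/
def base (p : X) : Set X := (trivializationAt (Fin E.rank → ℂ) E.Fiber p).baseSet

/-- The coordinates on the fibre of `E` at `x`, in the preferred trivialization of `E` at `p`; they
are zero if `x` is not in `E.base p`. -/
noncomputable def coords (p x : X) : E.Fiber x →ₗ[ℂ] (Fin E.rank → ℂ) :=
  (trivializationAt (Fin E.rank → ℂ) E.Fiber p).linearMapAt ℂ x

/-- The local section of `E` with constant coordinates `v` in the preferred trivialization of `E`
at `p`. -/
noncomputable def constSection (p : X) (v : Fin E.rank → ℂ) (x : X) : E.Fiber x :=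
  (trivializationAt (Fin E.rank → ℂ) E.Fiber p).symmₗ ℂ x v

lemma isOpen_base (p : X) : IsOpen (E.base p) := Bundle.Trivialization.open_baseSet _

lemma mem_base (p : X) : p ∈ E.base p := FiberBundle.mem_baseSet_trivializationAt _ _ _

lemma base_mem_nhds (p : X) : E.base p ∈ 𝓝 p := (E.isOpen_base p).mem_nhds (E.mem_base p)

variable {E}

lemma coords_apply {p x : X} (hx : x ∈ E.base p) (v : E.Fiber x) :
    E.coords p x v = (trivializationAt (Fin E.rank → ℂ) E.Fiber p (⟨x, v⟩ : E.Total)).2 := by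
  rw [coords, Bundle.Trivialization.coe_linearMapAt_of_mem _ hx]

lemma coords_constSection {p x : X} (hx : x ∈ E.base p) (v : Fin E.rank → ℂ) :
    E.coords p x (E.constSection p v x) = v :=
  Bundle.Trivialization.linearMapAt_symmₗ _ hx v

lemma coords_injective {p x : X} (hx : x ∈ E.base p) : Function.Injective (E.coords p x) :=
  Function.LeftInverse.injective
    (g := (trivializationAt (Fin E.rank → ℂ) E.Fiber p).symmₗ ℂ x)
    (Bundle.Trivialization.symmₗ_linearMapAt _ hx)

lemma contMDiffAt_section_iff {s : ∀ x, E.Fiber x} {p x : X} (hx : x ∈ E.base p) :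
    ContMDiffAt 𝓘(ℂ) (𝓘(ℂ).prod 𝓘(ℂ, Fin E.rank → ℂ)) ω (fun y => (⟨y, s y⟩ : E.Total)) x ↔
      ContMDiffAt 𝓘(ℂ) 𝓘(ℂ, Fin E.rank → ℂ) ω (fun y => E.coords p y (s y)) x := by
  rw [Bundle.Trivialization.contMDiffAt_section_iff
    (trivializationAt (Fin E.rank → ℂ) E.Fiber p) hx]
  refine EventuallyEq.contMDiffAt_iff ?_
  filter_upwards [(E.isOpen_base p).mem_nhds hx] with y hy
  rw [coords_apply hy]

lemma contMDiffAt_constSection {p x : X} (hx : x ∈ E.base p) (v : Fin E.rank → ℂ) :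
    ContMDiffAt 𝓘(ℂ) (𝓘(ℂ).prod 𝓘(ℂ, Fin E.rank → ℂ)) ω
      (fun y => (⟨y, E.constSection p v y⟩ : E.Total)) x := by
  rw [contMDiffAt_section_iff hx]
  refine (contMDiffAt_const (c := v)).congr_of_eventuallyEq ?_
  filter_upwards [(E.isOpen_base p).mem_nhds hx] with y hy
  rw [coords_constSection hy]

lemma Hom.contMDiffAt_section {F : HolBundle X} (f : E.Hom F) {s : ∀ x, E.Fiber x} {x : X}
    (hs : ContMDiffAt 𝓘(ℂ) (𝓘(ℂ).prod 𝓘(ℂ, Fin E.rank → ℂ)) ω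
      (fun y => (⟨y, s y⟩ : E.Total)) x) :
    ContMDiffAt 𝓘(ℂ) (𝓘(ℂ).prod 𝓘(ℂ, Fin F.rank → ℂ)) ω
      (fun y => (⟨y, f.app y (s y)⟩ : F.Total)) x :=
  (f.holomorphic.contMDiffAt (x := (⟨x, s x⟩ : E.Total))).comp x hs

end Coordinates

/-! ### Meromorphic sections and degrees of line bundles -/

section LineBundle

/-- The coordinate on the fibre at `x` of the line bundle `E`, in the preferred trivialization of
`E` at `p`. That `E` is a line bundle is expressed by `Unique (Fin E.rank)`. -/
noncomputable def lineCoord (E : HolBundle X) [Unique (Fin E.rank)] (p x : X) :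
    E.Fiber x →ₗ[ℂ] ℂ :=
  LinearMap.proj default ∘ₗ E.coords p x

/-- The order at `p` of the section `s` of the line bundle `E`. -/
noncomputable def lineOrd (E : HolBundle X) [Unique (Fin E.rank)] (s : ∀ x, E.Fiber x) (p : X) :
    WithTop ℤ :=
  ordAt (fun x => E.lineCoord p x (s x)) p

/-- `s` is a meromorphic section of the line bundle `E` which does not vanish identically near any
point. -/
structure IsLineFrame (E : HolBundle X) [Unique (Fin E.rank)] (s : ∀ x, E.Fiber x) : Prop where
  meroAt : ∀ p, MeroAt (fun x => E.lineCoord p x (s x)) p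
  ord_ne_top : ∀ p, E.lineOrd s p ≠ ⊤

/-- The local section generating the line bundle `E` over `E.base p`. -/
noncomputable def lineGen (E : HolBundle X) [Unique (Fin E.rank)] (p : X) : ∀ x, E.Fiber x :=
  E.constSection p 1

variable {E F : HolBundle X} [Unique (Fin E.rank)] [Unique (Fin F.rank)]

lemma lineCoord_injective {p x : X} (hx : x ∈ E.base p) :
    Function.Injective (E.lineCoord p x) := fun v w h => by
  refine coords_injective hx (funext fun i => ?_)
  rw [Unique.eq_default i]
  exact h

lemma lineCoord_ne_zero_iff {p x : X} (hx : x ∈ E.base p) {v : E.Fiber x} :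
    E.lineCoord p x v ≠ 0 ↔ v ≠ 0 :=
  (map_ne_zero_iff _ (lineCoord_injective hx))

lemma lineCoord_lineGen {p x : X} (hx : x ∈ E.base p) : E.lineCoord p x (E.lineGen p x) = 1 := by
  simp [lineCoord, lineGen, coords_constSection hx]

lemma eq_lineCoord_smul_lineGen {p x : X} (hx : x ∈ E.base p) (v : E.Fiber x) :
    v = E.lineCoord p x v • E.lineGen p x := by
  apply lineCoord_injective hx
  simp [lineCoord_lineGen hx]

lemma contMDiffAt_line_section_iff {s : ∀ x, E.Fiber x} {p x : X} (hx : x ∈ E.base p) :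
    ContMDiffAt 𝓘(ℂ) (𝓘(ℂ).prod 𝓘(ℂ, Fin E.rank → ℂ)) ω (fun y => (⟨y, s y⟩ : E.Total)) x ↔
      ContMDiffAt 𝓘(ℂ) 𝓘(ℂ) ω (fun y => E.lineCoord p y (s y)) x := by
  rw [contMDiffAt_section_iff hx, contMDiffAt_pi_space, Unique.forall_iff]
  rfl

lemma meromorphicAt_pi_unique_iff {ι : Type*} [Unique ι] [Fintype ι] {f : ℂ → ι → ℂ} {z : ℂ} :
    MeromorphicAt f z ↔ MeromorphicAt (fun w => f w default) z := by
  have h (n : ℕ) : AnalyticAt ℂ (fun w => (w - z) ^ n • f w) z ↔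
      AnalyticAt ℂ (fun w => (w - z) ^ n • f w default) z := by
    rw [show (fun w => (w - z) ^ n • f w) =
      fun w i => (fun (i : ι) (w : ℂ) => (w - z) ^ n • f w i) i w from rfl,
      analyticAt_pi_iff, Unique.forall_iff]
  exact exists_congr h

lemma localRep_default_eventuallyEq (s : ∀ x, E.Fiber x) (p : X) :
    (fun z => E.localRep p s z default) =ᶠ[𝓝 (chartAt ℂ p p)]
      (fun x => E.lineCoord p x (s x)) ∘ (chartAt ℂ p).symm := by
  filter_upwards [(tendsto_chartAt_symm p).eventually (E.base_mem_nhds p)] with z hz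
  simp [lineCoord, localRep, coords_apply hz]

lemma isMeromorphicSection_iff {s : ∀ x, E.Fiber x} :
    E.IsMeromorphicSection s ↔ ∀ p, MeroAt (fun x => E.lineCoord p x (s x)) p := by
  refine forall_congr' fun p => ?_
  rw [meromorphicAt_pi_unique_iff]
  exact MeromorphicAt.meromorphicAt_congr
    ((localRep_default_eventuallyEq s p).filter_mono nhdsWithin_le_nhds)

lemma detOrder_eq_lineOrd (s : Fin E.rank → ∀ x, E.Fiber x) (p : X) :
    E.detOrder s p = E.lineOrd (s default) p := by
  simp only [detOrder, Matrix.det_unique, Matrix.of_apply]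
  exact meromorphicOrderAt_congr
    ((localRep_default_eventuallyEq (s default) p).filter_mono nhdsWithin_le_nhds)

lemma hasDegree_iff_exists_isLineFrame {d : ℤ} :
    E.HasDegree d ↔
      ∃ s : ∀ x, E.Fiber x, E.IsLineFrame s ∧ ∑ᶠ p, (E.lineOrd s p).untop₀ = d := by
  constructor
  · rintro ⟨s, ⟨hm, ht⟩, hd⟩
    simp only [detOrder_eq_lineOrd] at ht hd
    exact ⟨s default, ⟨isMeromorphicSection_iff.1 (hm default), ht⟩, hd⟩
  · rintro ⟨s, hs, hd⟩
    refine ⟨fun _ => s, ⟨fun _ => isMeromorphicSection_iff.2 hs.meroAt, fun p => ?_⟩, ?_⟩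
    · simpa only [detOrder_eq_lineOrd] using hs.ord_ne_top p
    · simpa only [detOrder_eq_lineOrd] using hd

/-- The function by which a homomorphism of line bundles multiplies, in the preferred
trivializations at `p`. -/
noncomputable def Hom.coeff (f : E.Hom F) (p x : X) : ℂ :=
  F.lineCoord p x (f.app x (E.lineGen p x))

lemma Hom.lineCoord_app (f : E.Hom F) {p x : X} (hx : x ∈ E.base p) (v : E.Fiber x) :
    F.lineCoord p x (f.app x v) = f.coeff p x * E.lineCoord p x v := by
  conv_lhs => rw [eq_lineCoord_smul_lineGen hx v]
  simp [Hom.coeff, mul_comm]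

lemma Hom.contMDiffAt_coeff (f : E.Hom F) {p x : X} (hx : x ∈ E.base p) (hx' : x ∈ F.base p) :
    ContMDiffAt 𝓘(ℂ) 𝓘(ℂ) ω (f.coeff p) x :=
  (contMDiffAt_line_section_iff hx').1 (f.contMDiffAt_section (contMDiffAt_constSection hx 1))

/-- If `s` and `t` are meromorphic sections of `E`, then so is `(s / t) s`. -/
lemma IsLineFrame.exists_sq_div {s t : ∀ x, E.Fiber x} (hs : E.IsLineFrame s)
    (ht : E.IsLineFrame t) : ∃ u : ∀ x, E.Fiber x, E.IsLineFrame u ∧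
      ∀ p, (E.lineOrd u p).untop₀ =
        (E.lineOrd s p).untop₀ + ((E.lineOrd s p).untop₀ - (E.lineOrd t p).untop₀) := by
  -- The quotient of two vectors of a line does not depend on the coordinate on the line.
  let u : ∀ x, E.Fiber x := fun x => (E.lineCoord x x (s x) / E.lineCoord x x (t x)) • s x
  have key (p : X) : ((fun x => E.lineCoord p x (s x)) / fun x => E.lineCoord p x (t x)) *
      (fun x => E.lineCoord p x (s x)) =ᶠ[𝓝 p] fun x => E.lineCoord p x (u x) := by
    filter_upwards [E.base_mem_nhds p] with x hx
    have hc (v : E.Fiber x) :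
        E.lineCoord p x v = E.lineCoord x x v * E.lineCoord p x (E.lineGen x x) := by
      conv_lhs => rw [eq_lineCoord_smul_lineGen (E.mem_base x) v]
      simp
    have hg : E.lineCoord p x (E.lineGen x x) ≠ 0 := by
      rw [lineCoord_ne_zero_iff hx, ← lineCoord_ne_zero_iff (E.mem_base x),
        lineCoord_lineGen (E.mem_base x)]
      exact one_ne_zero
    simp only [Pi.mul_apply, Pi.div_apply, u, map_smul, smul_eq_mul]
    congr 1
    rw [hc (s x), hc (t x), mul_div_mul_right _ _ hg]
  have hord (p : X) : E.lineOrd u p =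
      E.lineOrd s p - E.lineOrd t p + E.lineOrd s p := by
    rw [lineOrd, ← ordAt_congr (key p), ordAt_mul ((hs.meroAt p).div (ht.meroAt p)) (hs.meroAt p),
      ordAt_div (hs.meroAt p) (ht.meroAt p)]
    rfl
  refine ⟨u, ⟨fun p => (((hs.meroAt p).div (ht.meroAt p)).mul (hs.meroAt p)).congr (key p),
    fun p => ?_⟩, fun p => ?_⟩
  all_goals
    obtain ⟨a, ha⟩ := WithTop.ne_top_iff_exists.1 (hs.ord_ne_top p)
    obtain ⟨b, hb⟩ := WithTop.ne_top_iff_exists.1 (ht.ord_ne_top p)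
    rw [hord, ← ha, ← hb, ← WithTop.LinearOrderedAddCommGroup.coe_sub, ← WithTop.coe_add]
  · exact WithTop.coe_ne_top
  · simp only [WithTop.untop₀_coe]
    ring

/-- A homomorphism of line bundles that vanishes nowhere is an isomorphism. -/
lemma Hom.isIso_of_coeff_ne_zero {f : E.Hom F} (hf : ∀ p, f.coeff p p ≠ 0) : f.IsIso := by
  let g (x : X) : F.Fiber x →ₗ[ℂ] E.Fiber x :=
    ((f.coeff x x)⁻¹ • F.lineCoord x x).smulRight (E.lineGen x x)
  have hfg (x : X) (w : F.Fiber x) : f.app x (g x w) = w := by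
    apply lineCoord_injective (F.mem_base x)
    rw [f.lineCoord_app (E.mem_base x)]
    simp [g, lineCoord_lineGen (E.mem_base x), hf x]
  have hgf (x : X) (v : E.Fiber x) : g x (f.app x v) = v := by
    apply lineCoord_injective (E.mem_base x)
    simp [g, lineCoord_lineGen (E.mem_base x), f.lineCoord_app (E.mem_base x), hf x]
  refine ⟨⟨g, fun v₀ => ?_⟩, hgf, hfg⟩
  rw [Bundle.contMDiffAt_totalSpace]
  refine ⟨Bundle.contMDiffAt_proj _, ?_⟩
  rw [contMDiffAt_pi_space, Unique.forall_iff]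
  obtain ⟨p, v⟩ := v₀
  have hproj : ContMDiffAt (𝓘(ℂ).prod 𝓘(ℂ, Fin F.rank → ℂ)) 𝓘(ℂ) ω
      (fun v : F.Total => v.proj) ⟨p, v⟩ := Bundle.contMDiffAt_proj _
  have hcoeff : ContMDiffAt (𝓘(ℂ).prod 𝓘(ℂ, Fin F.rank → ℂ)) 𝓘(ℂ) ω
      (fun v : F.Total => f.coeff p v.proj) ⟨p, v⟩ :=
    (f.contMDiffAt_coeff (E.mem_base p) (F.mem_base p)).comp (⟨p, v⟩ : F.Total) hproj
  have hid : ContMDiffAt (𝓘(ℂ).prod 𝓘(ℂ, Fin F.rank → ℂ))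
      (𝓘(ℂ).prod 𝓘(ℂ, Fin F.rank → ℂ)) ω (fun v : F.Total => v) ⟨p, v⟩ := contMDiffAt_id
  have hcoord := contMDiffAt_pi_space.1 (Bundle.contMDiffAt_totalSpace.1 hid).2 default
  refine (hcoord.div₀ hcoeff (hf p)).congr_of_eventuallyEq ?_
  filter_upwards [hproj.continuousAt.eventually (E.base_mem_nhds p),
    hproj.continuousAt.eventually (F.base_mem_nhds p),
    hcoeff.continuousAt.eventually_ne (hf p)] with w hwE hwF hw
  have h1 := f.lineCoord_app hwE (g w.proj w.2)
  rw [hfg] at h1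
  have h2 : E.lineCoord p w.proj (g w.proj w.2) =
    (trivializationAt (Fin E.rank → ℂ) E.Fiber p (⟨w.proj, g w.proj w.2⟩ : E.Total)).2 default := by
    simp [lineCoord, coords_apply hwE]
  have h3 : F.lineCoord p w.proj w.2 =
    (trivializationAt (Fin F.rank → ℂ) F.Fiber p w).2 default := by
    simp [lineCoord, coords_apply hwF]
  rw [← h2, Pi.div_apply, ← h3, h1, mul_div_cancel_left₀ _ hw]

variable [IsManifold 𝓘(ℂ) ω X]

/-- Near `p`, the section `s` has neither zeros nor poles except possibly at `p`. Holomorphy and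
vanishing of a section do not depend on the trivialization, so the order at a nearby point `q` can
be read in the trivialization at `p`. -/
lemma IsLineFrame.eventually_ord_eq_zero {s : ∀ x, E.Fiber x} (hs : E.IsLineFrame s) (p : X) :
    ∀ᶠ q in 𝓝[≠] p, E.lineOrd s q = 0 := by
  filter_upwards [(hs.meroAt p).eventually_contMDiffAt_ne_zero (hs.ord_ne_top p),
    nhdsWithin_le_nhds (E.base_mem_nhds p)] with q ⟨hq, h0⟩ hqp
  have hsec := (contMDiffAt_line_section_iff (E.mem_base q)).1
    ((contMDiffAt_line_section_iff hqp).2 hq)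
  refine hsec.ordAt_eq_zero_iff.2 ?_
  rw [lineCoord_ne_zero_iff (E.mem_base q)]
  exact (lineCoord_ne_zero_iff hqp).1 h0

lemma IsLineFrame.finite_support [CompactSpace X] {s : ∀ x, E.Fiber x} (hs : E.IsLineFrame s) :
    (fun p => (E.lineOrd s p).untop₀).HasFiniteSupport := by
  obtain ⟨t, ht⟩ := CompactSpace.elim_nhds_subcover
    (fun p => {q | q ≠ p → E.lineOrd s q = 0})
    (fun p => eventually_nhdsWithin_iff.1 (hs.eventually_ord_eq_zero p))
  refine t.finite_toSet.subset fun q hq => ?_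
  have hmem : q ∈ ⋃ x ∈ t, {q | q ≠ x → E.lineOrd s q = 0} := by rw [ht]; trivial
  simp only [Set.mem_iUnion] at hmem
  obtain ⟨x, hx, hqx⟩ := hmem
  by_cases h : q = x
  · exact h ▸ hx
  · exact absurd (by simp [hqx h]) hq

lemma HasDegree.two_mul_sub [CompactSpace X] {a b : ℤ} (ha : E.HasDegree a)
    (hb : E.HasDegree b) : E.HasDegree (a + (a - b)) := by
  obtain ⟨s, hs, rfl⟩ := hasDegree_iff_exists_isLineFrame.1 ha
  obtain ⟨t, ht, rfl⟩ := hasDegree_iff_exists_isLineFrame.1 hb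
  obtain ⟨u, hu, h⟩ := hs.exists_sq_div ht
  refine hasDegree_iff_exists_isLineFrame.2 ⟨u, hu, ?_⟩
  have hst := hs.finite_support
  have htt := ht.finite_support
  rw [finsum_congr h, ← finsum_sub_distrib hst htt]
  exact finsum_add_distrib hst (hst.sub htt)

/-- If the degree of a line bundle were ambiguous, then it would have arbitrarily small degrees. -/
lemma HasDegree.exists_le_of_ne [CompactSpace X] {a b : ℤ} (ha : E.HasDegree a)
    (hb : E.HasDegree b) (hab : a ≠ b) (N : ℤ) : ∃ d ≤ N, E.HasDegree d := by
  wlog hlt : a < b generalizing a b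
  · exact this hb ha hab.symm (by omega)
  have hk (k : ℕ) : E.HasDegree (a - k * (b - a)) ∧ E.HasDegree (a - k * (b - a) + (b - a)) := by
    induction k with
    | zero => simpa using ⟨ha, hb⟩
    | succ k ih =>
      refine ⟨?_, ?_⟩
      · convert ih.1.two_mul_sub ih.2 using 1
        push_cast
        ring
      · convert ih.1 using 1
        push_cast
        ring
  refine ⟨_, ?_, (hk (a - N).toNat).1⟩
  have h1 : a - N ≤ ((a - N).toNat : ℤ) := Int.self_le_toNat _
  nlinarith [Int.natCast_nonneg (a - N).toNat]

lemma Hom.SheafInjective.ordAt_coeff_ne_top {f : E.Hom F} (hf : f.SheafInjective) (p : X) :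
    ordAt (f.coeff p) p ≠ ⊤ := fun htop => by
  have h0 := (f.contMDiffAt_coeff (E.mem_base p)
    (F.mem_base p)).eventually_eq_zero_of_ordAt_eq_top htop
  obtain ⟨U, hU, hUo, hpU⟩ := mem_nhds_iff.1
    (h0.and (inter_mem (E.base_mem_nhds p) (F.base_mem_nhds p)))
  have := hf U hUo (E.lineGen p)
    (fun x hx => (contMDiffAt_constSection (hU hx).2.1 1).contMDiffWithinAt)
    (fun x hx => by
      apply lineCoord_injective (hU hx).2.2
      rw [map_zero]
      exact (hU hx).1) p hpU
  have h1 := lineCoord_lineGen (E.mem_base p)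
  rw [this, map_zero] at h1
  exact zero_ne_one h1

lemma Hom.lineOrd_app {f : E.Hom F} {s : ∀ x, E.Fiber x} (hs : E.IsLineFrame s) (p : X) :
    MeroAt (fun x => F.lineCoord p x (f.app x (s x))) p ∧
    F.lineOrd (fun x => f.app x (s x)) p = ordAt (f.coeff p) p + E.lineOrd s p := by
  have key : f.coeff p * (fun x => E.lineCoord p x (s x)) =ᶠ[𝓝 p]
      fun x => F.lineCoord p x (f.app x (s x)) := by
    filter_upwards [E.base_mem_nhds p] with x hx
    rw [f.lineCoord_app hx]
    rfl
  have hm := (f.contMDiffAt_coeff (E.mem_base p) (F.mem_base p)).meroAt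
  refine ⟨(hm.mul (hs.meroAt p)).congr key, ?_⟩
  rw [lineOrd, ← ordAt_congr key, ordAt_mul hm (hs.meroAt p)]
  rfl

/-- A line subsheaf of degree `d` of a line bundle `F` forces a degree `d' ≥ d` of `F`, with
equality only if the subsheaf is all of `F`: the difference counts the zeros of the inclusion. -/
lemma HasDegree.exists_ge_of_sheafInjective [CompactSpace X] {f : E.Hom F}
    (hf : f.SheafInjective) {d : ℤ} (hd : E.HasDegree d) :
    ∃ d', F.HasDegree d' ∧ d ≤ d' ∧ (d = d' → f.IsIso) := by
  obtain ⟨s, hs, rfl⟩ := hasDegree_iff_exists_isLineFrame.1 hd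
  have hsm (p : X) := f.contMDiffAt_coeff (E.mem_base p) (F.mem_base p)
  have hord (p : X) : (F.lineOrd (fun x => f.app x (s x)) p).untop₀ =
      (ordAt (f.coeff p) p).untop₀ + (E.lineOrd s p).untop₀ := by
    rw [(Hom.lineOrd_app hs p).2,
      WithTop.untop₀_add (hf.ordAt_coeff_ne_top p) (hs.ord_ne_top p)]
  have hfs : F.IsLineFrame (fun x => f.app x (s x)) := by
    refine ⟨fun p => (Hom.lineOrd_app hs p).1, fun p => ?_⟩
    rw [(Hom.lineOrd_app hs p).2]
    exact WithTop.add_ne_top.2 ⟨hf.ordAt_coeff_ne_top p, hs.ord_ne_top p⟩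
  have hnonneg (p : X) : 0 ≤ (ordAt (f.coeff p) p).untop₀ := by
    obtain ⟨a, ha⟩ := WithTop.ne_top_iff_exists.1 (hf.ordAt_coeff_ne_top p)
    have := (hsm p).ordAt_nonneg
    rw [← ha] at this ⊢
    simpa using this
  have hfin : (fun p => (ordAt (f.coeff p) p).untop₀).HasFiniteSupport := by
    have := hfs.finite_support.sub hs.finite_support
    simpa only [hord, Pi.sub_def, add_sub_cancel_right] using this
  have hsum := finsum_congr hord
  rw [finsum_add_distrib hfin hs.finite_support] at hsum
  refine ⟨_, hasDegree_iff_exists_isLineFrame.2 ⟨_, hfs, rfl⟩, ?_, fun heq => ?_⟩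
  · have := finsum_nonneg hnonneg
    omega
  · refine Hom.isIso_of_coeff_ne_zero fun p => (hsm p).ordAt_eq_zero_iff.1 ?_
    have h1 := single_le_finsum p hfin hnonneg
    have h2 := hnonneg p
    obtain ⟨a, ha⟩ := WithTop.ne_top_iff_exists.1 (hf.ordAt_coeff_ne_top p)
    have h3 : (ordAt (f.coeff p) p).untop₀ = 0 := by omega
    rw [← ha] at h3 ⊢
    simpa using h3

end LineBundle

/-! ### Subsheaves of line bundles -/

section Subsheaves

variable {E F G : HolBundle X}

/-- A subsheaf of a line bundle has rank at most one: if `e₁`, `e₂` are part of a local frame, with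
images `c₁`, `c₂` in the line bundle, then `c₂ e₁ - c₁ e₂` is mapped to zero. -/
lemma Hom.SheafInjective.rank_le_one [Nonempty X] [Unique (Fin F.rank)] {f : E.Hom F}
    (hf : f.SheafInjective) : E.rank ≤ 1 := by
  by_contra! h
  obtain ⟨p⟩ := ‹Nonempty X›
  let i : Fin E.rank := ⟨0, by omega⟩
  let j : Fin E.rank := ⟨1, h⟩
  have hij : i ≠ j := by simp [i, j]
  let e (i : Fin E.rank) : ∀ x, E.Fiber x := E.constSection p (Pi.single i 1)
  let c (i : Fin E.rank) (x : X) : ℂ := F.lineCoord p x (f.app x (e i x))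
  let U := E.base p ∩ F.base p
  have hU : IsOpen U := (E.isOpen_base p).inter (F.isOpen_base p)
  have hp : p ∈ U := ⟨E.mem_base p, F.mem_base p⟩
  have hc (i : Fin E.rank) {x : X} (hx : x ∈ U) : ContMDiffAt 𝓘(ℂ) 𝓘(ℂ) ω (c i) x :=
    (contMDiffAt_line_section_iff hx.2).1 (f.contMDiffAt_section (contMDiffAt_constSection hx.1 _))
  have hcoord (a b : ℂ) {x : X} (hx : x ∈ U) :
      E.coords p x (a • e i x - b • e j x) = a • Pi.single i 1 - b • Pi.single j 1 := by
    simp [e, coords_constSection hx.1]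
  have hzero := hf U hU (fun x => c j x • e i x - c i x • e j x)
    (fun x hx => by
      refine ((contMDiffAt_section_iff hx.1).2 ?_).contMDiffWithinAt
      have : ContMDiffAt 𝓘(ℂ) 𝓘(ℂ, Fin E.rank → ℂ) ω
          (fun x => c j x • (Pi.single i 1 : Fin E.rank → ℂ) - c i x • Pi.single j 1) x :=
        ((hc j hx).smul contMDiffAt_const).sub ((hc i hx).smul contMDiffAt_const)
      refine this.congr_of_eventuallyEq ?_
      filter_upwards [hU.mem_nhds hx] with y hy
      exact hcoord _ _ hy)
    (fun x hx => by
      apply lineCoord_injective hx.2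
      simp only [map_sub, map_smul, map_zero, smul_eq_mul]
      change c j x * c i x - c i x * c j x = 0
      ring)
  have hci {x : X} (hx : x ∈ U) : c i x = 0 := by
    have h1 := hcoord (c j x) (c i x) hx
    rw [hzero x hx, map_zero] at h1
    have h2 := congrFun h1 j
    simpa [hij.symm] using h2
  have h3 := hf U hU (e i) (fun x hx => (contMDiffAt_constSection hx.1 _).contMDiffWithinAt)
    (fun x hx => lineCoord_injective hx.2 (by rw [map_zero]; exact hci hx)) p hp
  have h4 := coords_constSection hp.1 (Pi.single i (1 : ℂ))
  rw [show E.constSection p (Pi.single i 1) p = 0 from h3, map_zero] at h4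
  simpa using congrFun h4 i

/-- A homomorphism of line bundles that vanishes on a line subsheaf is zero. -/
lemma Hom.app_eq_zero_of_comp_eq_zero [IsManifold 𝓘(ℂ) ω X] [Unique (Fin E.rank)]
    [Unique (Fin F.rank)] [Unique (Fin G.rank)] {f : E.Hom F} (hf : f.SheafInjective)
    {g : F.Hom G} (hgf : ∀ x v, g.app x (f.app x v) = 0) (p : X) (v : F.Fiber p) :
    g.app p v = 0 := by
  have hgs := g.contMDiffAt_coeff (F.mem_base p) (G.mem_base p)
  have hfs := f.contMDiffAt_coeff (E.mem_base p) (F.mem_base p)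
  have hmul : g.coeff p * f.coeff p =ᶠ[𝓝 p] 0 := by
    filter_upwards [F.base_mem_nhds p] with x hx
    have h := g.lineCoord_app hx (f.app x (E.lineGen p x))
    rw [hgf, map_zero] at h
    exact h.symm
  have htop : ordAt (g.coeff p) p = ⊤ := by
    have h0 : ordAt (0 : X → ℂ) p = ⊤ := by
      rw [ordAt, meromorphicOrderAt_eq_top_iff]
      simp
    have h1 := ordAt_mul hgs.meroAt hfs.meroAt
    rw [ordAt_congr hmul, h0] at h1
    exact (WithTop.add_eq_top.1 h1.symm).resolve_right (hf.ordAt_coeff_ne_top p)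
  have h2 := (hgs.eventually_eq_zero_of_ordAt_eq_top htop).self_of_nhds
  apply lineCoord_injective (G.mem_base p)
  rw [g.lineCoord_app (F.mem_base p), h2, zero_mul, map_zero]

end Subsheaves

/-! ### Replacing bundles by zero -/

section ZeroBundle

lemma hasDegree_iff_of_rank_eq_zero {E : HolBundle X} (hE : E.rank = 0) {d : ℤ} :
    E.HasDegree d ↔ d = 0 := by
  have : IsEmpty (Fin E.rank) := by rw [hE]; infer_instance
  have h0 (s : Fin E.rank → ∀ x, E.Fiber x) (p : X) : E.detOrder s p = 0 := by
    classical
    simp [detOrder, Matrix.det_isEmpty, meromorphicOrderAt_const]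
  constructor
  · rintro ⟨s, -, hd⟩
    simpa [h0] using hd.symm
  · rintro rfl
    exact ⟨isEmptyElim, ⟨isEmptyElim, fun p => by simp [h0]⟩, by simp [h0]⟩

variable (X) in
/-- The zero vector bundle. -/
noncomputable def zeroBundle : HolBundle X where
  rank := 0
  Fiber := Bundle.Trivial X (Fin 0 → ℂ)
  addCommGroup := fun _ => inferInstanceAs (AddCommGroup (Fin 0 → ℂ))
  module := fun _ => inferInstanceAs (Module ℂ (Fin 0 → ℂ))
  topFiber := fun _ => inferInstanceAs (TopologicalSpace (Fin 0 → ℂ))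
  vectorBundle := Bundle.Trivial.vectorBundle ℂ X (Fin 0 → ℂ)
  holomorphic := Bundle.Trivial.contMDiffVectorBundle _

/-- The zero homomorphism. -/
noncomputable def zeroHom (E F : HolBundle X) : E.Hom F where
  app _ := 0
  holomorphic := (Bundle.contMDiff_zeroSection ℂ F.Fiber).comp (Bundle.contMDiff_proj E.Fiber)

/-- The identity homomorphism. -/
noncomputable def idHom (E : HolBundle X) : E.Hom E where
  app _ := LinearMap.id
  holomorphic := contMDiff_id

/-- The bundle `E` or the zero bundle, according to `b`. -/
noncomputable def mask (E : HolBundle X) : Bool → HolBundle X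
  | true => E
  | false => zeroBundle X

/-- The homomorphism induced by `f` between bundles that may have been replaced by zero. -/
noncomputable def Hom.mask {E F : HolBundle X} (f : E.Hom F) : ∀ b c, (E.mask b).Hom (F.mask c)
  | true, true => f
  | true, false => zeroHom _ _
  | false, _ => zeroHom _ _

/-- The inclusion of `E` or of the zero bundle in `E`. -/
noncomputable def maskIncl (E : HolBundle X) : ∀ b, (E.mask b).Hom E
  | true => idHom E
  | false => zeroHom _ _

lemma maskIncl_sheafInjective (E : HolBundle X) (b : Bool) : (E.maskIncl b).SheafInjective := by
  cases b with
  | true => exact fun U _ s _ h => h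
  | false => exact fun U _ s _ _ x _ => Subsingleton.elim (α := Fin 0 → ℂ) _ _

lemma maskIncl_mask {E F : HolBundle X} (f : E.Hom F) {b c : Bool}
    (h : b = true → c = false → ∀ x v, f.app x v = 0) (x : X) (v : (E.mask b).Fiber x) :
    (F.maskIncl c).app x ((f.mask b c).app x v) = f.app x ((E.maskIncl b).app x v) := by
  match b, c with
  | true, true => rfl
  | true, false => exact (h rfl rfl x v).symm
  | false, true => exact (map_zero (f.app x)).symm
  | false, false => exact (map_zero (f.app x)).symm

lemma rank_mask (E : HolBundle X) (b : Bool) : (E.mask b).rank = if b then E.rank else 0 := by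
  cases b <;> rfl

lemma HasDegree.mask {E : HolBundle X} {d : ℤ} (hd : E.HasDegree d) (b : Bool) :
    (E.mask b).HasDegree (if b then d else 0) := by
  cases b with
  | true => exact hd
  | false => exact (hasDegree_iff_of_rank_eq_zero rfl).2 rfl

lemma not_isIso_maskIncl_false [Nonempty X] (E : HolBundle X) [Unique (Fin E.rank)] :
    ¬ (E.maskIncl false).IsIso := by
  rintro ⟨g, -, hg⟩
  obtain ⟨p⟩ := ‹Nonempty X›
  have h1 : E.lineGen p p = 0 := (hg p (E.lineGen p p)).symm
  have h2 := lineCoord_lineGen (E.mem_base p)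
  rw [h1, map_zero] at h2
  exact zero_ne_one h2

end ZeroBundle

end HolBundle

/-! ### Slopes -/

namespace ChainType

variable {n : ℕ}

lemma slope_le_slope {α : Fin n → ℝ} {t u : ChainType n} (hr : ∀ i, t.rank i = u.rank i)
    (hd : ∀ i, t.deg i ≤ u.deg i) : t.slope α ≤ u.slope α := by
  simp only [slope, hr]
  gcongr
  exact hd _

lemma slope_lt_slope {α : Fin n → ℝ} {t u : ChainType n} (hr : ∀ i, t.rank i = u.rank i)
    (hu : ∃ i, u.rank i ≠ 0) (hd : ∀ i, t.deg i ≤ u.deg i) (hlt : ∃ i, t.deg i < u.deg i) :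
    t.slope α < u.slope α := by
  have h1 : ∑ i, (t.deg i : ℝ) < ∑ i, (u.deg i : ℝ) := by
    obtain ⟨i, hi⟩ := hlt
    exact Finset.sum_lt_sum (fun i _ => by exact_mod_cast hd i)
      ⟨i, Finset.mem_univ i, by exact_mod_cast hi⟩
  have h2 : 0 < ∑ i, (u.rank i : ℝ) := by
    obtain ⟨i, hi⟩ := hu
    exact Finset.sum_pos' (fun i _ => by positivity)
      ⟨i, Finset.mem_univ i, by exact_mod_cast Nat.pos_of_ne_zero hi⟩
  simp only [slope, hr]
  gcongr

/-- The type complementary to the `i`-th standard one: `(0, …, 0, rᵢ₊₁, …, rₙ; …)`. -/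
def tail (t : ChainType n) (i : Fin (n + 1)) : ChainType n where
  rank j := if i < j then t.rank j else 0
  deg j := if i < j then t.deg j else 0

/-- The slope of a chain is a weighted mean of those of a subchain and its quotient. -/
lemma slope_lt_slope_tail {α : Fin n → ℝ} {t : ChainType n} (ht : ∀ i, t.rank i ≠ 0) {k : Fin n}
    (h : slope α (t.standard k.castSucc) < slope α t) :
    slope α t < slope α (t.tail k.castSucc) := by
  have split (f : Fin (n + 1) → ℝ) : ∑ j, f j =
      (∑ j, if j ≤ k.castSucc then f j else 0) + ∑ j, if k.castSucc < j then f j else 0 := by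
    rw [← Finset.sum_add_distrib]
    refine Finset.sum_congr rfl fun j _ => ?_
    by_cases hj : j ≤ k.castSucc
    · simp [hj]
    · simp [not_le.1 hj, hj]
  have split' : ∑ m : Fin n, α m * (t.rank m.succ : ℝ) =
      (∑ m : Fin n, α m * if m.succ ≤ k.castSucc then (t.rank m.succ : ℝ) else 0) +
        ∑ m : Fin n, α m * if k.castSucc < m.succ then (t.rank m.succ : ℝ) else 0 := by
    rw [← Finset.sum_add_distrib]
    refine Finset.sum_congr rfl fun m _ => ?_
    by_cases hm : m.succ ≤ k.castSucc
    · rw [if_pos hm, if_neg (not_lt.2 hm), mul_zero, add_zero]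
    · simp [not_le.1 hm, hm]
  have hpos1 : 0 < ∑ j, (if j ≤ k.castSucc then (t.rank j : ℝ) else 0) :=
    Finset.sum_pos' (fun j _ => by positivity)
      ⟨k.castSucc, Finset.mem_univ _, by simpa using Nat.pos_of_ne_zero (ht _)⟩
  have hpos2 : 0 < ∑ j, (if k.castSucc < j then (t.rank j : ℝ) else 0) :=
    Finset.sum_pos' (fun j _ => by positivity)
      ⟨k.succ, Finset.mem_univ _, by
        simpa [Fin.castSucc_lt_succ] using Nat.pos_of_ne_zero (ht _)⟩
  simp only [slope, standard, tail, Nat.cast_ite, Int.cast_ite, Nat.cast_zero, Int.cast_zero]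
    at h ⊢
  rw [split fun j => (t.rank j : ℝ), split fun j => (t.deg j : ℝ), split'] at h ⊢
  rw [div_lt_div_iff₀ (by positivity) (by positivity)] at h ⊢
  nlinarith

end ChainType

/-! ### Chains of line bundles -/

namespace HolChain

variable {X : Type*} [TopologicalSpace X] [ChartedSpace ℂ X] {n : ℕ}

/-- If `φ_{k+1} = 0`, then `(0, …, 0, E_{k+1}, …, Eₙ)` is a subchain. -/
noncomputable def tailSubchain (C : HolChain X n) (k : Fin n) (hk : ∀ x v, (C.map k).app x v = 0) :
    C.Subchain where
  chain :=
    { bundle := fun i => (C.bundle i).mask (decide (k.castSucc < i))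
      map := fun m => (C.map m).mask _ _ }
  incl i := (C.bundle i).maskIncl _
  incl_injective i := (C.bundle i).maskIncl_sheafInjective _
  comm m x v := by
    refine HolBundle.maskIncl_mask (C.map m) (fun h1 h2 => ?_) x v
    have h1 : k.castSucc < m.succ := of_decide_eq_true h1
    have h2 : ¬ k.castSucc < m.castSucc := of_decide_eq_false h2
    obtain rfl : m = k := by
      simp only [Fin.lt_def, Fin.val_castSucc, Fin.val_succ] at h1 h2
      exact Fin.ext (by omega)
    exact hk

lemma tailSubchain_hasType {C : HolChain X n} {t : ChainType n} (hC : C.HasType t) (k : Fin n)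
    (hk : ∀ x v, (C.map k).app x v = 0) :
    (C.tailSubchain k hk).chain.HasType (t.tail k.castSucc) := fun i => by
  refine ⟨?_, ?_⟩
  · simp [tailSubchain, ChainType.tail, HolBundle.rank_mask, (hC i).1]
  · simpa [tailSubchain, ChainType.tail] using (hC i).2.mask (decide (k.castSucc < i))

lemma tailSubchain_isProper [Nonempty X] {C : HolChain X n} (hC : ∀ i, (C.bundle i).rank = 1)
    (k : Fin n) (hk : ∀ x v, (C.map k).app x v = 0) : (C.tailSubchain k hk).IsProper := by
  refine ⟨⟨k.succ, ?_⟩, fun h => ?_⟩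
  · simp [tailSubchain, HolBundle.rank_mask, hC]
  · have : Unique (Fin (C.bundle k.castSucc).rank) := by rw [hC]; infer_instance
    refine HolBundle.not_isIso_maskIncl_false (C.bundle k.castSucc) ?_
    have h0 : decide (k.castSucc < k.castSucc) = false := by simp
    rw [← h0]
    exact h k.castSucc

/-- The degrees of a semistable chain of line bundles that has a proper subchain are unambiguous:
otherwise the chain would have arbitrarily small slopes. -/
lemma IsSemistable.deg_unique [IsManifold 𝓘(ℂ) ω X] [CompactSpace X] {C : HolChain X n}
    {α : Fin n → ℝ} (hss : C.IsSemistable α) {d : Fin (n + 1) → ℤ}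
    (hC : C.HasType ⟨fun _ => 1, d⟩) {S : C.Subchain} (hS : S.IsProper) {t' : ChainType n}
    (ht' : S.chain.HasType t') {i : Fin (n + 1)} {e : ℤ} (he : (C.bundle i).HasDegree e) :
    e = d i := by
  by_contra hne
  have : Unique (Fin (C.bundle i).rank) := by rw [(hC i).1]; infer_instance
  -- With this degree of `Eᵢ`, the slope of the chain would be less than that of the subchain.
  obtain ⟨c, hcN, hc⟩ := he.exists_le_of_ne (hC i).2 hne
    (⌊t'.slope α * (n + 1) - (∑ j, (d j : ℝ)) + d i - ∑ k, α k⌋ - 1)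
  have hle := hss ⟨fun _ => 1, Function.update d i c⟩
    (fun j => ⟨(hC j).1, by
      by_cases hj : j = i
      · subst hj
        simpa using hc
      · simpa [hj] using (hC j).2⟩) S hS t' ht'
  have hsum : ∑ j, ((Function.update d i c j : ℤ) : ℝ) = ∑ j, (d j : ℝ) - d i + c := by
    have h1 : ∑ j, Function.update d i c j = ∑ j, d j - d i + c := by
      rw [Finset.sum_update_of_mem (Finset.mem_univ i), ← Finset.add_sum_erase _ _
        (Finset.mem_univ i), Finset.sdiff_singleton_eq_erase]
      ring
    exact_mod_cast h1
  generalize t'.slope α = σ at hle hcN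
  rw [ChainType.slope, le_div_iff₀ (by simp; positivity), hsum] at hle
  simp only [Nat.cast_one, mul_one, Finset.sum_const, Finset.card_univ, Fintype.card_fin,
    nsmul_eq_mul, Nat.cast_add] at hle
  have h2 : (c : ℝ) ≤ ⌊σ * (n + 1) - (∑ j, (d j : ℝ)) + d i - ∑ k, α k⌋ - 1 := by
    exact_mod_cast hcN
  have h3 := Int.floor_le (σ * (n + 1) - (∑ j, (d j : ℝ)) + d i - ∑ k, α k)
  linarith

end HolChain

theorem proposition3p3 {X : Type*} [TopologicalSpace X] [T2Space X] [CompactSpace X]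
    [ConnectedSpace X] [ChartedSpace ℂ X] [IsManifold 𝓘(ℂ) ω X]
    {n : ℕ} (d : Fin (n + 1) → ℤ) (C : HolChain X n) (hC : C.HasType ⟨fun _ => 1, d⟩)
    (α : Fin n → ℝ) (hα : α ∈ ChainType.H (⟨fun _ => 1, d⟩ : ChainType n)) :
    C.IsSemistable α ↔ C.IsStable α := by
  refine ⟨fun hss t ht S hS t' ht' => ?_, fun hs t ht S hS t' ht' => (hs t ht S hS t' ht').le⟩
  have hrk (i : Fin (n + 1)) : (C.bundle i).rank = 1 := (hC i).1
  have hline (i : Fin (n + 1)) : Nonempty (Unique (Fin (C.bundle i).rank)) := by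
    rw [hrk]; exact ⟨inferInstance⟩
  have huniq {i : Fin (n + 1)} {e : ℤ} (he : (C.bundle i).HasDegree e) : e = d i :=
    hss.deg_unique hC hS ht' he
  obtain rfl : t = ⟨fun _ => 1, d⟩ := by
    obtain ⟨r, e⟩ := t
    obtain rfl : r = fun _ => 1 := funext fun i => (ht i).1.symm.trans (hC i).1
    obtain rfl : e = d := funext fun i => huniq (ht i).2
    rfl
  have hle (i : Fin (n + 1)) : t'.rank i ≤ 1 := by
    obtain ⟨_⟩ := hline i
    exact (ht' i).1 ▸ (S.incl_injective i).rank_le_one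
  have hdeg0 {i : Fin (n + 1)} (hi : t'.rank i = 0) : t'.deg i = 0 :=
    (HolBundle.hasDegree_iff_of_rank_eq_zero ((ht' i).1.trans hi)).1 (ht' i).2
  have hdeg1 {i : Fin (n + 1)} (hi : t'.rank i = 1) :
      t'.deg i ≤ d i ∧ (t'.deg i = d i → (S.incl i).IsIso) := by
    obtain ⟨_⟩ := hline i
    have : Unique (Fin (S.chain.bundle i).rank) := by rw [(ht' i).1, hi]; infer_instance
    obtain ⟨e, he, h1, h2⟩ := (ht' i).2.exists_ge_of_sheafInjective (S.incl_injective i)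
    obtain rfl := huniq he
    exact ⟨h1, h2⟩
  -- If `F_{k+1} ≠ 0` but `F_k = 0`, then `φ_{k+1} = 0`, and `(0, …, 0, L_{k+1}, …, Lₙ)` is a
  -- subchain that contradicts semistability.
  have hdown (k : Fin n) (hk : t'.rank k.succ = 1) : t'.rank k.castSucc = 1 := by
    by_contra h1
    have h0 : t'.rank k.castSucc = 0 := by have := hle k.castSucc; omega
    obtain ⟨_⟩ := hline k.succ
    obtain ⟨_⟩ := hline k.castSucc
    have : Unique (Fin (S.chain.bundle k.succ).rank) := by
      rw [(ht' k.succ).1, hk]; infer_instance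
    have hφ : ∀ x v, (C.map k).app x v = 0 :=
      HolBundle.Hom.app_eq_zero_of_comp_eq_zero (S.incl_injective k.succ) fun x v => by
        have : IsEmpty (Fin (S.chain.bundle k.castSucc).rank) := by
          rw [(ht' k.castSucc).1, h0]; infer_instance
        have hz : (S.chain.map k).app x v = 0 :=
          HolBundle.coords_injective (HolBundle.mem_base _ x) (Subsingleton.elim _ _)
        rw [← S.comm, hz, map_zero]
    exact absurd (hss _ hC _ (HolChain.tailSubchain_isProper hrk k hφ) _
      (HolChain.tailSubchain_hasType hC k hφ))
      (not_le.2 (ChainType.slope_lt_slope_tail (fun _ => one_ne_zero) (hα k)))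
  have hanti {i j : Fin (n + 1)} (hij : i ≤ j) (hj : t'.rank j = 1) : t'.rank i = 1 := by
    induction j using Fin.induction with
    | zero => rwa [Fin.le_zero_iff.1 hij]
    | succ k ih =>
      rcases hij.eq_or_lt with rfl | hlt
      · exact hj
      · exact ih (Fin.le_castSucc_iff.2 hlt) (hdown k hj)
  obtain ⟨⟨i₀, hi₀⟩, hiso⟩ := hS
  rw [(ht' i₀).1] at hi₀
  have h0 : t'.rank 0 = 1 := hanti (Fin.zero_le i₀) (by have := hle i₀; omega)
  by_cases hlast : t'.rank (Fin.last n) = 1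
  · have hall (i : Fin (n + 1)) : t'.rank i = 1 := hanti (Fin.le_last i) hlast
    obtain ⟨i, hi⟩ := not_forall.1 hiso
    exact ChainType.slope_lt_slope hall ⟨0, one_ne_zero⟩ (fun i => (hdeg1 (hall i)).1)
      ⟨i, lt_of_le_of_ne (hdeg1 (hall i)).1 fun h => hi ((hdeg1 (hall i)).2 h)⟩
  · obtain ⟨k, hk1, hk0⟩ : ∃ k : Fin n, t'.rank k.castSucc = 1 ∧ t'.rank k.succ ≠ 1 := by
      by_contra! h
      exact hlast (Fin.induction (motive := fun i => t'.rank i = 1) h0 h (Fin.last n))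
    have hgt {j : Fin (n + 1)} (hj : ¬ j ≤ k.castSucc) : t'.rank j = 0 := by
      have h1 : t'.rank j ≠ 1 := fun h1 =>
        hk0 (hanti (Fin.castSucc_lt_iff_succ_le.1 (not_le.1 hj)) h1)
      have := hle j
      omega
    refine (ChainType.slope_le_slope (fun j => ?_) fun j => ?_).trans_lt (hα k)
    all_goals
      by_cases hj : j ≤ k.castSucc
    · simpa [ChainType.standard, hj] using hanti hj hk1
    · simpa [ChainType.standard, hj] using hgt hj
    · simpa [ChainType.standard, hj] using (hdeg1 (hanti hj hk1)).1
    · simpa [ChainType.standard, hj] using (hdeg0 (hgt hj)).le
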